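/- Let $(V,g)$ be a finite-dimensional real inner product space with $\dim V\ge 4$. Let the orthogonal group $\mathrm{O}(V)$ act on covariant $k$-tensors on $V$ by $(A\cdot R)(x_1,\dots,x_k)=R(A^{-1}x_1,\dots,A^{-1}x_k)$, and equip these tensors with the inner product $\langle R,S\rangle=\sum_{i_1,\dots,i_k}R(e_{i_1},\dots,e_{i_k})S(e_{i_1},\dots,e_{i_k})$, where $(e_i)$ is any orthonormal basis of $V$. Let $\mathcal T$ be the space of algebraic curvature tensors on $V$, that is, of the covariant $4$-tensors $R$ such that for all $x,y,z,t\in V$ $$R(x,y,z,t)=-R(y,x,z,t)=-R(x,y,t,z)=R(z,t,x,y)$$ (that is, $R\in S^2\Lambda^2V$) and $$R(x,y,z,t)+R(y,z,x,t)+R(z,x,y,t)=0$$ (the first Bianchi identity). For symmetric bilinear forms $r,s$ on $V$ let $r\odot s$ be their Kulkarni--Nomizu product, $$(r\odot s)(x,y,z,t)=r(x,z)s(y,t)+r(y,t)s(x,z)-r(x,t)s(y,z)-r(y,z)s(x,t),$$ and let $S_0^2V$ be the space of symmetric bilinear forms $h$ on $V$ with zero trace $\sum_i h(e_i,e_i)=0$.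 Then, as an $\mathrm{O}(V)$-module, $\mathcal T$ is the direct sum $$\mathcal T=\mathbb R\,(g\odot g)\ \oplus\ \mathcal Z\ \oplus\ \mathcal W$$ of three irreducible $\mathrm{O}(V)$-submodules, where $\mathcal Z=\{g\odot h : h\in S_0^2V\}$ and $\mathcal W$ is the orthogonal complement of $\mathbb R\,(g\odot g)\oplus\mathcal Z$ in $\mathcal T$. (Irreducible means: nonzero, with no invariant subspaces other than $0$ and the whole module.) -/

import Mathlib

open scoped RealInnerProductSpace

namespace AlgCurv

variable (V : Type*) [NormedAddCommGroup V] [InnerProductSpace ℝ V]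

/-- Covariant `k`-tensors on `V`. -/
abbrev CovTensor (k : ℕ) : Type _ := MultilinearMap ℝ (fun _ : Fin k => V) ℝ

/-- The natural action of the orthogonal group `O(V)` on covariant `k`-tensors:
`(A • R)(x₁, …, x_k) = R(A⁻¹ x₁, …, A⁻¹ x_k)`. -/
noncomputable def tensorRep (k : ℕ) : Representation ℝ (V ≃ₗᵢ[ℝ] V) (CovTensor V k) where
  toFun A := MultilinearMap.compLinearMapₗ (fun _ => (A⁻¹).toLinearEquiv.toLinearMap)
  map_one' := by ext R v; simp [MultilinearMap.compLinearMap_apply]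
  map_mul' A B := by ext R v; simp [MultilinearMap.compLinearMap_apply]

variable {V}

theorem tensorRep_apply {k : ℕ} (A : V ≃ₗᵢ[ℝ] V) (R : CovTensor V k) (v : Fin k → V) :
    tensorRep V k A R v = R (fun i => A.symm (v i)) := rfl

theorem tensorRep_apply_four (A : V ≃ₗᵢ[ℝ] V) (R : CovTensor V 4) (x y z t : V) :
    tensorRep V 4 A R ![x, y, z, t] = R ![A.symm x, A.symm y, A.symm z, A.symm t] := by
  rw [tensorRep_apply]
  congr 1
  ext i
  fin_cases i <;> rfl

variable (V)

/-- `S²Λ²V`, as the space of covariant `4`-tensors that are skew in the first two arguments, skew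
in the last two arguments, and symmetric under exchange of the two pairs. -/
def symSqExtSq : Submodule ℝ (CovTensor V 4) where
  carrier := {R | (∀ x y z t, R ![y, x, z, t] = - R ![x, y, z, t]) ∧
    (∀ x y z t, R ![x, y, t, z] = - R ![x, y, z, t]) ∧
    (∀ x y z t, R ![z, t, x, y] = R ![x, y, z, t])}
  zero_mem' := by simp
  add_mem' := by
    rintro R S ⟨h1, h2, h3⟩ ⟨k1, k2, k3⟩
    refine ⟨fun x y z t => ?_, fun x y z t => ?_, fun x y z t => ?_⟩
    · rw [add_apply, add_apply, h1, k1]; ring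
    · rw [add_apply, add_apply, h2, k2]; ring
    · rw [add_apply, add_apply, h3, k3]
  smul_mem' := by
    rintro c R ⟨h1, h2, h3⟩
    refine ⟨fun x y z t => ?_, fun x y z t => ?_, fun x y z t => ?_⟩
    · rw [smul_apply, smul_apply, h1, smul_neg]
    · rw [smul_apply, smul_apply, h2, smul_neg]
    · rw [smul_apply, smul_apply, h3]

/-- The `4`-tensors satisfying the first Bianchi identity. -/
def bianchiTensors : Submodule ℝ (CovTensor V 4) where
  carrier := {R | ∀ x y z t, R ![x, y, z, t] + R ![y, z, x, t] + R ![z, x, y, t] = 0}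
  zero_mem' := by simp
  add_mem' := by
    intro R S h k x y z t
    have := h x y z t
    have := k x y z t
    simp only [add_apply]
    linarith
  smul_mem' := by
    intro c R h x y z t
    simp only [smul_apply, ← smul_add]
    rw [h x y z t, smul_zero]

/-- The space `𝒯` of algebraic curvature tensors on `V`, as an `O(V)`-submodule of the space of
`4`-tensors: the elements of `S²Λ²V` satisfying the first Bianchi identity. -/
def curvTensors : Subrepresentation (tensorRep V 4) where
  toSubmodule := symSqExtSq V ⊓ bianchiTensors V
  apply_mem_toSubmodule := by
    rintro A R ⟨⟨h1, h2, h3⟩, h4⟩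
    refine ⟨⟨fun x y z t => ?_, fun x y z t => ?_, fun x y z t => ?_⟩, fun x y z t => ?_⟩
    · rw [tensorRep_apply_four, tensorRep_apply_four, h1]
    · rw [tensorRep_apply_four, tensorRep_apply_four, h2]
    · rw [tensorRep_apply_four, tensorRep_apply_four, h3]
    · rw [tensorRep_apply_four, tensorRep_apply_four, tensorRep_apply_four]
      exact h4 _ _ _ _

/-- `S²V`: the symmetric bilinear forms. -/
def symForms : Submodule ℝ (LinearMap.BilinForm ℝ V) where
  carrier := {h | ∀ x y, h x y = h y x}
  zero_mem' := by simp
  add_mem' := by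
    intro r s hr hs x y
    rw [LinearMap.add_apply, LinearMap.add_apply, LinearMap.add_apply, LinearMap.add_apply,
      hr x y, hs x y]
  smul_mem' := by
    intro c r hr x y
    rw [LinearMap.smul_apply, LinearMap.smul_apply, LinearMap.smul_apply, LinearMap.smul_apply,
      hr x y]

/-- The metric `g`, as an element of `S²V`. -/
noncomputable def metricForm : symForms V :=
  ⟨innerₗ V, fun x y => by simp [real_inner_comm]⟩

variable {V}

/-- The Kulkarni–Nomizu product `r ∧⃝ s` of two bilinear forms, as a `4`-tensor:
`(x, y, z, t) ↦ r(x,z)s(y,t) + r(y,t)s(x,z) - r(x,t)s(y,z) - r(y,z)s(x,t)`. -/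
def kulkarniNomizu (r s : LinearMap.BilinForm ℝ V) : CovTensor V 4 where
  toFun v := r (v 0) (v 2) * s (v 1) (v 3) + r (v 1) (v 3) * s (v 0) (v 2)
    - r (v 0) (v 3) * s (v 1) (v 2) - r (v 1) (v 2) * s (v 0) (v 3)
  map_update_add' := by
    intro _ v i x y
    have : ‹DecidableEq (Fin 4)› = instDecidableEqFin 4 := Subsingleton.elim _ _
    subst this
    fin_cases i <;> simp [Function.update] <;> ring
  map_update_smul' := by
    intro _ v i c x
    have : ‹DecidableEq (Fin 4)› = instDecidableEqFin 4 := Subsingleton.elim _ _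
    subst this
    fin_cases i <;> simp [Function.update] <;> ring

theorem kulkarniNomizu_apply (r s : LinearMap.BilinForm ℝ V) (v : Fin 4 → V) :
    kulkarniNomizu r s v = r (v 0) (v 2) * s (v 1) (v 3) + r (v 1) (v 3) * s (v 0) (v 2)
      - r (v 0) (v 3) * s (v 1) (v 2) - r (v 1) (v 2) * s (v 0) (v 3) := rfl

variable (V)

/-- The linear map `g ∧⃝ · : S²V → V^{⊗4}`, `h ↦ g ∧⃝ h`. -/
noncomputable def metricKN : symForms V →ₗ[ℝ] CovTensor V 4 where
  toFun h := kulkarniNomizu (metricForm V : LinearMap.BilinForm ℝ V) h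
  map_add' h k := by
    ext v
    simp [kulkarniNomizu_apply]
    ring
  map_smul' c h := by
    ext v
    simp [kulkarniNomizu_apply]
    ring

/-- The `O(V)`-module `ℝ g ∧⃝ g`. -/
noncomputable def scalarPart : Subrepresentation (tensorRep V 4) where
  toSubmodule := Submodule.span ℝ {metricKN V (metricForm V)}
  apply_mem_toSubmodule := by
    intro A R hR
    obtain ⟨c, rfl⟩ := Submodule.mem_span_singleton.1 hR
    refine Submodule.mem_span_singleton.2 ⟨c, ?_⟩
    rw [map_smul]
    congr 1
    ext v
    change kulkarniNomizu (innerₗ V) (innerₗ V) v =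
      kulkarniNomizu (innerₗ V) (innerₗ V) (fun i => A.symm (v i))
    simp [kulkarniNomizu_apply]

variable {V}

theorem sum_bilin_eq {ι κ : Type*} [Fintype ι] [Fintype κ] (b : OrthonormalBasis ι ℝ V)
    (c : OrthonormalBasis κ ℝ V) (h : LinearMap.BilinForm ℝ V) :
    ∑ i, h (c i) (c i) = ∑ i, h (b i) (b i) := by
  classical
  have e1 : ∀ x : V, h x x = ∑ p, ∑ q, (⟪b p, x⟫ * ⟪x, b q⟫) * h (b p) (b q) := by
    intro x
    conv_lhs => rw [← b.sum_repr' x]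
    simp only [map_sum, LinearMap.sum_apply, map_smul, LinearMap.smul_apply, smul_eq_mul,
      Finset.mul_sum]
    rw [Finset.sum_comm]
    refine Finset.sum_congr rfl fun p _ => Finset.sum_congr rfl fun q _ => ?_
    rw [real_inner_comm (b q) x]
    ring
  simp_rw [e1]
  rw [Finset.sum_comm]
  refine Finset.sum_congr rfl fun p _ => ?_
  rw [Finset.sum_comm]
  simp_rw [← Finset.sum_mul, c.sum_inner_mul_inner, b.inner_eq_ite]
  simp

theorem sum_tensor_eq {ι κ : Type*} [Fintype ι] [Fintype κ] (b : OrthonormalBasis ι ℝ V)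
    (c : OrthonormalBasis κ ℝ V) {k : ℕ} (R S : CovTensor V k) :
    ∑ i : Fin k → κ, R (fun a => c (i a)) * S (fun a => c (i a)) =
      ∑ i : Fin k → ι, R (fun a => b (i a)) * S (fun a => b (i a)) := by
  classical
  have e1 : ∀ (R : CovTensor V k) (x : Fin k → V),
      R x = ∑ p : Fin k → ι, (∏ a, ⟪b (p a), x a⟫) * R (fun a => b (p a)) := by
    intro R x
    have : x = fun a => ∑ j, ⟪b j, x a⟫ • b j := funext fun a => (b.sum_repr' (x a)).symm
    conv_lhs => rw [this]
    rw [MultilinearMap.map_sum]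
    refine Finset.sum_congr rfl fun p _ => ?_
    rw [MultilinearMap.map_smul_univ, smul_eq_mul]
  have e2 : ∀ p q : Fin k → ι,
      ∑ i : Fin k → κ, (∏ a, ⟪b (p a), c (i a)⟫) * (∏ a, ⟪b (q a), c (i a)⟫) =
        if p = q then 1 else 0 := by
    intro p q
    simp_rw [← Finset.prod_mul_distrib]
    rw [← Fintype.prod_sum (fun a j => ⟪b (p a), c j⟫ * ⟪b (q a), c j⟫)]
    simp_rw [fun (a : Fin k) (j : κ) => real_inner_comm (c j) (b (q a)),
      c.sum_inner_mul_inner, b.inner_eq_ite]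
    rw [Finset.prod_ite_zero]
    simp [funext_iff]
  calc ∑ i : Fin k → κ, R (fun a => c (i a)) * S (fun a => c (i a))
      = ∑ i : Fin k → κ, ∑ p : Fin k → ι, ∑ q : Fin k → ι,
          ((∏ a, ⟪b (p a), c (i a)⟫) * (∏ a, ⟪b (q a), c (i a)⟫)) *
            (R (fun a => b (p a)) * S (fun a => b (q a))) := by
        refine Finset.sum_congr rfl fun i _ => ?_
        rw [e1 R, e1 S, Finset.sum_mul_sum]
        refine Finset.sum_congr rfl fun p _ => Finset.sum_congr rfl fun q _ => ?_
        ring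
    _ = ∑ p : Fin k → ι, ∑ q : Fin k → ι, (if p = q then 1 else 0) *
            (R (fun a => b (p a)) * S (fun a => b (q a))) := by
        rw [Finset.sum_comm]
        refine Finset.sum_congr rfl fun p _ => ?_
        rw [Finset.sum_comm]
        refine Finset.sum_congr rfl fun q _ => ?_
        rw [← Finset.sum_mul, e2]
    _ = _ := by simp

variable [FiniteDimensional ℝ V]

/-- The trace of a bilinear form on `V`, computed in an orthonormal basis. -/
noncomputable def bilinTrace (h : LinearMap.BilinForm ℝ V) : ℝ :=
  ∑ i, h (stdOrthonormalBasis ℝ V i) (stdOrthonormalBasis ℝ V i)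

/-- The inner product `⟨R, S⟩ = ∑ R_{i₁…i_k} S_{i₁…i_k}` on `k`-tensors, computed in an
orthonormal basis. -/
noncomputable def tensorInner {k : ℕ} (R S : CovTensor V k) : ℝ :=
  ∑ i : Fin k → Fin (Module.finrank ℝ V),
    R (fun a => stdOrthonormalBasis ℝ V (i a)) * S (fun a => stdOrthonormalBasis ℝ V (i a))

theorem tensorInner_rep {k : ℕ} (A : V ≃ₗᵢ[ℝ] V) (R S : CovTensor V k) :
    tensorInner (tensorRep V k A R) S = tensorInner R (tensorRep V k A⁻¹ S) := by
  unfold tensorInner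
  rw [← sum_tensor_eq (stdOrthonormalBasis ℝ V) ((stdOrthonormalBasis ℝ V).map A)]
  refine Finset.sum_congr rfl fun i _ => ?_
  simp only [tensorRep_apply, OrthonormalBasis.map_apply, LinearIsometryEquiv.symm_apply_apply]
  rfl

variable (V)

/-- `S₀²V`: the traceless elements of `S²V`. -/
noncomputable def tracelessForms : Submodule ℝ (symForms V) where
  carrier := {h | bilinTrace (h : LinearMap.BilinForm ℝ V) = 0}
  zero_mem' := by simp [bilinTrace]
  add_mem' := by
    intro h k hh hk
    simp only [Set.mem_ofPred_eq, bilinTrace] at *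
    simp [Finset.sum_add_distrib, hh, hk]
  smul_mem' := by
    intro c h hh
    simp only [Set.mem_ofPred_eq, bilinTrace] at *
    simp [← Finset.mul_sum, hh]

/-- The `O(V)`-module `𝒵 = g ∧⃝ S₀²V`. -/
noncomputable def tracelessPart : Subrepresentation (tensorRep V 4) where
  toSubmodule := (tracelessForms V).map (metricKN V)
  apply_mem_toSubmodule := by
    rintro A _ ⟨⟨h, hs⟩, ht, rfl⟩
    have ht' : ∑ i, h (stdOrthonormalBasis ℝ V i) (stdOrthonormalBasis ℝ V i) = 0 := ht
    refine ⟨⟨h.compl₁₂ A.symm.toLinearEquiv.toLinearMap A.symm.toLinearEquiv.toLinearMap,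
      fun x y => hs _ _⟩, ?_, ?_⟩
    · change ∑ i, h (A.symm (stdOrthonormalBasis ℝ V i)) (A.symm (stdOrthonormalBasis ℝ V i)) = 0
      rw [← ht', ← sum_bilin_eq _ ((stdOrthonormalBasis ℝ V).map A.symm)]
      simp
    · ext v
      change kulkarniNomizu (innerₗ V) _ v =
        kulkarniNomizu (innerₗ V) h (fun i => A.symm (v i))
      simp [kulkarniNomizu_apply]

/-- The `O(V)`-module `𝒲` of Weyl tensors: the orthogonal complement of `ℝ g ∧⃝ g + 𝒵` in `𝒯`. -/
noncomputable def weylPart : Subrepresentation (tensorRep V 4) where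
  toSubmodule :=
    { carrier := {R | R ∈ (curvTensors V).toSubmodule ∧
        ∀ S ∈ (scalarPart V).toSubmodule ⊔ (tracelessPart V).toSubmodule, tensorInner R S = 0}
      zero_mem' := ⟨zero_mem _, fun S _ => by simp [tensorInner]⟩
      add_mem' := by
        rintro P Q ⟨hPT, hP⟩ ⟨hQT, hQ⟩
        refine ⟨add_mem hPT hQT, fun S hS => ?_⟩
        have h1 := hP S hS
        have h2 := hQ S hS
        simp only [tensorInner] at *
        simp [add_mul, Finset.sum_add_distrib, h1, h2]
      smul_mem' := by
        rintro c P ⟨hPT, hP⟩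
        refine ⟨Submodule.smul_mem _ c hPT, fun S hS => ?_⟩
        have h1 := hP S hS
        simp only [tensorInner] at *
        simp [mul_assoc, ← Finset.mul_sum, h1] }
  apply_mem_toSubmodule := by
    rintro A R ⟨hRT, hR⟩
    refine ⟨(curvTensors V).apply_mem_toSubmodule A hRT, fun S hS => ?_⟩
    rw [tensorInner_rep]
    exact hR _ ((scalarPart V ⊔ tracelessPart V).apply_mem_toSubmodule A⁻¹ hS)

end AlgCurv

/-! The tensor inner product is positive definite, so the splitting is an orthogonal one; since
`tensorInner R (metricKN V h)` is four times the pairing of the Ricci contraction of `R` with `h`,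
Weyl tensors are the curvature tensors with zero Ricci contraction.

Irreducibility comes from one criterion, `isIrreducible_of_functional`. Let φ be a functional whose
translates separate points. If a module had a proper nonzero submodule, that submodule and its
orthogonal complement would each contain a vector representing φ there, fixed by the stabilizer of φ
and not killed by φ. A combination of these two orthogonal vectors is fixed and killed by φ, yet
nonzero. So it suffices that a stabilizer-fixed vector killed by φ vanishes.

Here φ is the sectional curvature of a coordinate plane. Its translates separate because sectional
curvatures on orthonormal pairs determine a curvature tensor. Its stabilizer contains the coordinate
reflections, which leave only the components R(i,j,i,j), and the permutations preserving the plane,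
which make many of these equal. In each part, the value on the plane together with a trace condition
then forces all of them to vanish. Four independent directions provide a nonzero Weyl tensor. -/

namespace AlgCurv

/-! ### Irreducibility criterion for orthogonal representations -/

section Criterion

variable {G E : Type*} [Group G] [AddCommGroup E] [Module ℝ E]

/-- A form without isotropic vectors restricts to a nondegenerate form on every subspace. -/
theorem restrict_nondegenerate_of_anisotropic (B : LinearMap.BilinForm ℝ E) (hB : B.IsSymm)
    (hpos : ∀ v, B v v = 0 → v = 0) (U : Submodule ℝ E) : (B.restrict U).Nondegenerate := by
  have hr : (B.restrict U).IsRefl := fun x y h => by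
    have : B y x = B x y := hB.eq y x
    simpa [this] using h
  refine (LinearMap.IsRefl.nondegenerate_iff_separatingLeft hr).2 fun x hx => ?_
  exact Subtype.ext (hpos x (hx x))

variable [FiniteDimensional ℝ E]

/-- A functional that does not vanish on an invariant subspace is represented there by a vector
which is fixed by the stabilizer of the functional. -/
theorem exists_stabilizer_fixed (ρ : Representation ℝ G E) (B : LinearMap.BilinForm ℝ E)
    (hB : B.IsSymm) (hpos : ∀ v, B v v = 0 → v = 0)
    (hinv : ∀ g v w, B (ρ g v) w = B v (ρ g⁻¹ w)) (φ : E →ₗ[ℝ] ℝ)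
    (hsep : ∀ v, (∀ g, φ (ρ g v) = 0) → v = 0) (σ : Subrepresentation ρ) (hσ : σ ≠ ⊥) :
    ∃ u ∈ σ.toSubmodule, (∀ g, φ ∘ₗ ρ g = φ → ρ g u = u) ∧ φ u ≠ 0 ∧
      ∀ v ∈ σ.toSubmodule, B u v = φ v := by
  have hnd := restrict_nondegenerate_of_anisotropic B hB hpos σ.toSubmodule
  -- The Riesz representative of φ restricted to the submodule.
  set u := (LinearMap.BilinForm.toDual (B.restrict σ.toSubmodule) hnd).symm
    (φ ∘ₗ σ.toSubmodule.subtype) with hu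
  have huv : ∀ v ∈ σ.toSubmodule, B u v = φ v := fun v hv =>
    LinearMap.BilinForm.apply_toDual_symm_apply (B := B.restrict σ.toSubmodule) (hB := hnd)
      (φ ∘ₗ σ.toSubmodule.subtype) ⟨v, hv⟩
  refine ⟨u, u.2, fun g hg => ?_, fun h0 => hσ ?_, huv⟩
  · have hg' : φ ∘ₗ ρ g⁻¹ = φ := by
      conv_lhs => rw [← hg]
      ext v
      simp
    have hmem : ρ g u - u ∈ σ.toSubmodule :=
      sub_mem (σ.apply_mem_toSubmodule g u.2) u.2
    -- With d = ρ g u - u, invariance gives B(ρ g u, d) = φ(ρ g⁻¹ d) = φ(d) = B(u, d), so B(d, d) =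
    -- 0.
    refine sub_eq_zero.1 (hpos _ ?_)
    have h2 : φ (ρ g⁻¹ (ρ g u - u)) = φ (ρ g u - u) := LinearMap.congr_fun hg' _
    rw [map_sub B, LinearMap.sub_apply, hinv, huv _ hmem,
      huv _ (σ.apply_mem_toSubmodule _ hmem), h2, sub_self]
  · have hu0 : (u : E) = 0 := hpos _ (by rw [huv _ u.2, h0])
    refine Subrepresentation.toSubmodule_injective (eq_bot_iff.2 fun v hv => ?_)
    refine hsep v fun g => ?_
    rw [← huv _ (σ.apply_mem_toSubmodule g hv), hu0, map_zero, LinearMap.zero_apply]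

/-- Irreducibility criterion: a nonzero orthogonal representation is irreducible if it has a
functional `φ` whose translates separate points, and such that `φ` does not vanish on nonzero
vectors fixed by its stabilizer. -/
theorem isIrreducible_of_functional [Nontrivial E] (ρ : Representation ℝ G E)
    (B : LinearMap.BilinForm ℝ E) (hB : B.IsSymm) (hpos : ∀ v, B v v = 0 → v = 0)
    (hinv : ∀ g v w, B (ρ g v) w = B v (ρ g⁻¹ w)) (φ : E →ₗ[ℝ] ℝ)
    (hsep : ∀ v, (∀ g, φ (ρ g v) = 0) → v = 0)
    (hfix : ∀ v, (∀ g, φ ∘ₗ ρ g = φ → ρ g v = v) → φ v = 0 → v = 0) :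
    ρ.IsIrreducible := by
  have hbt : (⊥ : Subrepresentation ρ) ≠ ⊤ := fun h =>
    bot_ne_top (α := Submodule ℝ E) (congrArg Subrepresentation.toSubmodule h)
  refine { exists_pair_ne := ⟨⊥, ⊤, hbt⟩, eq_bot_or_eq_top := fun σ => ?_ }
  by_contra! hσ
  let τ : Subrepresentation ρ :=
    { toSubmodule := B.orthogonal σ.toSubmodule
      apply_mem_toSubmodule := fun g v hv w hw => by
        change B w (ρ g v) = 0
        rw [← inv_inv g, ← hinv]
        exact hv _ (σ.apply_mem_toSubmodule _ hw) }
  have hc := LinearMap.BilinForm.isCompl_orthogonal_of_restrict_nondegenerate hB.isRefl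
    (restrict_nondegenerate_of_anisotropic B hB hpos σ.toSubmodule)
  have hτ : τ ≠ ⊥ := fun h => by
    have h' : B.orthogonal σ.toSubmodule = ⊥ := congrArg Subrepresentation.toSubmodule h
    rw [h'] at hc
    exact hσ.2 (Subrepresentation.toSubmodule_injective (eq_top_of_isCompl_bot hc))
  obtain ⟨u, hu, huf, hu0, huv⟩ := exists_stabilizer_fixed ρ B hB hpos hinv φ hsep σ hσ.1
  obtain ⟨w, hw, hwf, hw0, hwv⟩ := exists_stabilizer_fixed ρ B hB hpos hinv φ hsep τ hτ
  -- The coefficients are chosen so that φ kills the combination. Pairing it with u then leaves φ w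
  -- * φ u, because u and w are orthogonal and B u u = φ u.
  have h0 : φ w • u - φ u • w = 0 := by
    refine hfix _ (fun g hg => ?_) ?_
    · rw [map_sub, map_smul, map_smul, huf g hg, hwf g hg]
    · simp [mul_comm]
  have h1 : B u (φ w • u - φ u • w) = 0 := by rw [h0, map_zero]
  have h2 : B u w = 0 := hw u hu
  rw [map_sub, map_smul, map_smul, h2, huv u hu, smul_zero, sub_zero,
    smul_eq_mul] at h1
  exact mul_ne_zero hw0 hu0 h1

end Criterion

/-! ### The inner product on tensors and the criterion for tensor modules -/

section Bilin

variable {V : Type*} [NormedAddCommGroup V] [InnerProductSpace ℝ V] [FiniteDimensional ℝ V]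

variable (V) in
/-- The inner product of `k`-tensors as a bilinear form. -/
noncomputable def tensorForm (k : ℕ) : LinearMap.BilinForm ℝ (CovTensor V k) :=
  LinearMap.mk₂ ℝ tensorInner
    (fun R R' S => by simp [tensorInner, add_mul, Finset.sum_add_distrib])
    (fun c R S => by simp [tensorInner, mul_assoc, Finset.mul_sum])
    (fun R S S' => by simp [tensorInner, mul_add, Finset.sum_add_distrib])
    (fun c R S => by simp [tensorInner, mul_left_comm, Finset.mul_sum])

theorem tensorForm_apply {k : ℕ} (R S : CovTensor V k) :
    tensorForm V k R S = tensorInner R S := rfl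

theorem tensorForm_isSymm (k : ℕ) : (tensorForm V k).IsSymm :=
  ⟨fun R S => by simp [tensorForm_apply, tensorInner, mul_comm]⟩

theorem eq_zero_of_tensorInner_self {k : ℕ} (R : CovTensor V k) (h : tensorInner R R = 0) :
    R = 0 := by
  refine Module.Basis.ext_multilinear (fun _ => (stdOrthonormalBasis ℝ V).toBasis) fun i => ?_
  have := (Finset.sum_eq_zero_iff_of_nonneg fun i _ => mul_self_nonneg _).1 h i
    (Finset.mem_univ _)
  simpa using this

/-- The criterion `isIrreducible_of_functional` for modules of tensors. -/
theorem isIrreducible_toRepresentation {k : ℕ} (σ : Subrepresentation (tensorRep V k))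
    (hσ : ∃ R ∈ σ.toSubmodule, R ≠ 0) (φ : CovTensor V k →ₗ[ℝ] ℝ)
    (hsep : ∀ R ∈ σ.toSubmodule, (∀ A, φ (tensorRep V k A R) = 0) → R = 0)
    (hfix : ∀ R ∈ σ.toSubmodule,
      (∀ A, (∀ S ∈ σ.toSubmodule, φ (tensorRep V k A S) = φ S) → tensorRep V k A R = R) →
        φ R = 0 → R = 0) :
    Representation.IsIrreducible (V := σ.toSubmodule) σ.toRepresentation := by
  obtain ⟨R, hR, hR0⟩ := hσ
  have : Nontrivial σ.toSubmodule := ⟨⟨R, hR⟩, 0, fun h => hR0 (congrArg Subtype.val h)⟩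
  refine isIrreducible_of_functional (E := σ.toSubmodule) σ.toRepresentation
    ((tensorForm V k).restrict σ.toSubmodule)
    ⟨fun R S => (tensorForm_isSymm k).eq _ _⟩
    (fun R h => Subtype.ext (eq_zero_of_tensorInner_self R.1 h))
    (fun A R S => tensorInner_rep A R.1 S.1) (φ ∘ₗ σ.toSubmodule.subtype)
    (fun R h => Subtype.ext (hsep R.1 R.2 h))
    (fun R h h0 => Subtype.ext (hfix R.1 R.2 (fun A hA => ?_) h0))
  refine congrArg Subtype.val (h A (LinearMap.ext fun S => ?_))
  exact hA S.1 S.2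

end Bilin

/-! ### Multilinearity in individual arguments -/

section Slots

variable {V : Type*} [NormedAddCommGroup V] [InnerProductSpace ℝ V] (R : CovTensor V 4)

theorem map_add_first (x x' y z t : V) :
    R ![x + x', y, z, t] = R ![x, y, z, t] + R ![x', y, z, t] :=
  R.cons_add ![y, z, t] x x'

theorem map_smul_first (c : ℝ) (x y z t : V) : R ![c • x, y, z, t] = c * R ![x, y, z, t] :=
  R.cons_smul ![y, z, t] c x

theorem map_smul_four (a b c d : ℝ) (x y z t : V) :
    R ![a • x, b • y, c • z, d • t] = a * b * c * d * R ![x, y, z, t] := by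
  have h := R.map_smul_univ ![a, b, c, d] ![x, y, z, t]
  have hv : (fun i => ![a, b, c, d] i • ![x, y, z, t] i) = ![a • x, b • y, c • z, d • t] := by
    ext i; fin_cases i <;> rfl
  rw [hv] at h
  rw [h, Fin.prod_univ_four]
  rfl

end Slots

/-! ### Curvature symmetries and determination by sectional curvature -/

section Symmetries

variable {V : Type*} [NormedAddCommGroup V] [InnerProductSpace ℝ V] {R : CovTensor V 4}

theorem skew_left (hR : R ∈ (curvTensors V).toSubmodule) (x y z t : V) :
    R ![y, x, z, t] = -R ![x, y, z, t] := hR.1.1 x y z t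

theorem skew_right (hR : R ∈ (curvTensors V).toSubmodule) (x y z t : V) :
    R ![x, y, t, z] = -R ![x, y, z, t] := hR.1.2.1 x y z t

theorem pair_symm (hR : R ∈ (curvTensors V).toSubmodule) (x y z t : V) :
    R ![z, t, x, y] = R ![x, y, z, t] := hR.1.2.2 x y z t

theorem bianchi (hR : R ∈ (curvTensors V).toSubmodule) (x y z t : V) :
    R ![x, y, z, t] + R ![y, z, x, t] + R ![z, x, y, t] = 0 := hR.2 x y z t

theorem swap_both (hR : R ∈ (curvTensors V).toSubmodule) (x y z t : V) :
    R ![y, x, t, z] = R ![x, y, z, t] := by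
  rw [skew_left hR, skew_right hR, neg_neg]

theorem apply_self_left (hR : R ∈ (curvTensors V).toSubmodule) (x z t : V) :
    R ![x, x, z, t] = 0 := by
  linarith [skew_left hR x x z t]

theorem map_add_second (hR : R ∈ (curvTensors V).toSubmodule) (x y y' z t : V) :
    R ![x, y + y', z, t] = R ![x, y, z, t] + R ![x, y', z, t] := by
  rw [skew_left hR, map_add_first, skew_left hR x y, skew_left hR x y']
  ring

theorem map_add_third (hR : R ∈ (curvTensors V).toSubmodule) (x y z z' t : V) :
    R ![x, y, z + z', t] = R ![x, y, z, t] + R ![x, y, z', t] := by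
  rw [pair_symm hR, map_add_first, pair_symm hR x, pair_symm hR x]

theorem map_add_fourth (hR : R ∈ (curvTensors V).toSubmodule) (x y z t t' : V) :
    R ![x, y, z, t + t'] = R ![x, y, z, t] + R ![x, y, z, t'] := by
  rw [pair_symm hR, map_add_second hR, pair_symm hR x, pair_symm hR x]

/-- A curvature tensor is determined by its sectional curvatures. -/
theorem eq_zero_of_sectional (hR : R ∈ (curvTensors V).toSubmodule)
    (h : ∀ x y, R ![x, y, x, y] = 0) : R = 0 := by
  -- Polarization in the second and fourth arguments, then in the first and third, makes `R` skew in
  -- the first and third arguments as well. The three Bianchi terms are then equal, so 3R = 0.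
  have h1 : ∀ x y z, R ![x, y, x, z] = 0 := fun x y z => by
    have := h x (y + z)
    rw [map_add_second hR, map_add_fourth hR, map_add_fourth hR, h, h] at this
    linarith [pair_symm hR x y x z]
  have h2 : ∀ x y z t, R ![x, y, z, t] = -R ![z, y, x, t] := fun x y z t => by
    have := h1 (x + z) y t
    rw [map_add_first, map_add_third hR, map_add_third hR, h1, h1] at this
    linarith
  ext v
  have hv : v = ![v 0, v 1, v 2, v 3] := by ext i; fin_cases i <;> rfl
  rw [hv, zero_apply]
  generalize v 0 = x, v 1 = y, v 2 = z, v 3 = t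
  linarith [bianchi hR x y z t, h2 x y z t, skew_left hR z y x t, skew_left hR x z y t,
    h2 z x y t, skew_left hR x y z t]

/-- A curvature tensor is determined by its sectional curvatures on orthonormal pairs. -/
theorem eq_zero_of_sectional_orthonormal (hR : R ∈ (curvTensors V).toSubmodule)
    (h : ∀ x y, ‖x‖ = 1 → ‖y‖ = 1 → ⟪x, y⟫ = 0 → R ![x, y, x, y] = 0) : R = 0 := by
  have h1 : ∀ x y, ‖x‖ = 1 → ⟪x, y⟫ = 0 → R ![x, y, x, y] = 0 := fun x y hx hxy => by
    by_cases hy : y = 0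
    · subst hy
      simpa using map_smul_four R 1 0 1 0 x 0 x 0
    have hy' : ‖y‖ ≠ 0 := norm_ne_zero_iff.2 hy
    have := h x (‖y‖⁻¹ • y) hx (by rw [norm_smul, norm_inv, norm_norm, inv_mul_cancel₀ hy'])
      (by rw [real_inner_smul_right, hxy, mul_zero])
    have h2 := map_smul_four R 1 ‖y‖⁻¹ 1 ‖y‖⁻¹ x y x y
    rw [one_smul, this] at h2
    simpa [hy] using h2.symm
  -- Gram–Schmidt: the component of y along x contributes nothing, by skewness.
  have h2 : ∀ x y, ‖x‖ = 1 → R ![x, y, x, y] = 0 := fun x y hx => by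
    have hx2 : ⟪x, x⟫ = 1 := by rw [real_inner_self_eq_norm_sq, hx, one_pow]
    have h3 := h1 x (y + (-⟪x, y⟫) • x) hx (by
      rw [inner_add_right, real_inner_smul_right, hx2]; ring)
    have h4 : ∀ z t, R ![x, (-⟪x, y⟫) • x, z, t] = 0 := fun z t => by
      rw [skew_left hR, map_smul_first, apply_self_left hR, mul_zero, neg_zero]
    rw [map_add_second hR, h4, map_add_fourth hR, pair_symm hR x ((-⟪x, y⟫) • x) x y, h4] at h3
    simpa using h3
  refine eq_zero_of_sectional hR fun x y => ?_
  by_cases hx : x = 0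
  · subst hx
    simpa using map_smul_four R 0 1 0 1 0 y 0 y
  have hx' : ‖x‖ ≠ 0 := norm_ne_zero_iff.2 hx
  have h3 := h2 (‖x‖⁻¹ • x) y (by rw [norm_smul, norm_inv, norm_norm, inv_mul_cancel₀ hx'])
  have h4 := map_smul_four R ‖x‖⁻¹ 1 ‖x‖⁻¹ 1 x y x y
  rw [one_smul, h3] at h4
  simpa [hx] using h4.symm

end Symmetries

/-! ### Tensors invariant under the stabilizer of a coordinate plane -/

section Invariance

variable {V : Type*} [NormedAddCommGroup V] [InnerProductSpace ℝ V] {ι : Type*} [Fintype ι]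

/-- Any two orthonormal pairs are related by an isometry. -/
theorem exists_isometry_of_pair (b : OrthonormalBasis ι ℝ V) {p q : ι} (hpq : p ≠ q) {x y : V}
    (hx : ‖x‖ = 1) (hy : ‖y‖ = 1) (hxy : ⟪x, y⟫ = 0) :
    ∃ A : V ≃ₗᵢ[ℝ] V, A (b p) = x ∧ A (b q) = y := by
  classical
  have : FiniteDimensional ℝ V := b.toBasis.finiteDimensional_of_finite
  let v : ι → V := fun i => if i = p then x else y
  have hv : Orthonormal ℝ (Set.domRestrict {p, q} v) := by
    constructor
    · rintro ⟨i, rfl | rfl⟩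
      · simpa [v, Set.domRestrict] using hx
      · simpa [v, hpq.symm, Set.domRestrict] using hy
    · rintro ⟨i, rfl | rfl⟩ ⟨j, rfl | rfl⟩ hij
      · exact absurd rfl hij
      · simpa [v, hpq.symm, Set.domRestrict] using hxy
      · simpa [v, hpq.symm, Set.domRestrict, real_inner_comm] using hxy
      · exact absurd rfl hij
  obtain ⟨c, hc⟩ := hv.exists_orthonormalBasis_extension_of_card_eq
    (Module.finrank_eq_card_basis b.toBasis)
  refine ⟨b.equiv c (Equiv.refl ι), ?_, ?_⟩
  · rw [b.equiv_apply_basis]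
    simpa [v] using hc p (by simp)
  · rw [b.equiv_apply_basis]
    simpa [v, hpq.symm] using hc q (by simp)

/-- The sectional curvature functional `R ↦ R(x, y, x, y)`. -/
def sectional (x y : V) : CovTensor V 4 →ₗ[ℝ] ℝ where
  toFun R := R ![x, y, x, y]
  map_add' _ _ := rfl
  map_smul' _ _ := rfl

theorem sectional_apply (x y : V) (R : CovTensor V 4) : sectional x y R = R ![x, y, x, y] := rfl

/-- The translates of a sectional curvature functional separate curvature tensors. -/
theorem eq_zero_of_sectional_translates (b : OrthonormalBasis ι ℝ V) {p q : ι} (hpq : p ≠ q)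
    {R : CovTensor V 4} (hR : R ∈ (curvTensors V).toSubmodule)
    (h : ∀ A, sectional (b p) (b q) (tensorRep V 4 A R) = 0) : R = 0 := by
  refine eq_zero_of_sectional_orthonormal hR fun x y hx hy hxy => ?_
  obtain ⟨A, rfl, rfl⟩ := exists_isometry_of_pair b hpq hx hy hxy
  have := h A.symm
  rwa [sectional_apply, tensorRep_apply_four] at this

/-- `R` is fixed by every isometry that preserves the sectional curvatures of the plane
spanned by `x` and `y`. -/
def IsPlaneInvariant (R : CovTensor V 4) (x y : V) : Prop :=
  ∀ A : V ≃ₗᵢ[ℝ] V, (∀ S ∈ (curvTensors V).toSubmodule,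
    sectional x y (tensorRep V 4 A S) = sectional x y S) → tensorRep V 4 A R = R

theorem IsPlaneInvariant.apply {R : CovTensor V 4} {x y : V} (h : IsPlaneInvariant R x y)
    (A : V ≃ₗᵢ[ℝ] V) (hA : ∀ S ∈ (curvTensors V).toSubmodule,
      S ![A x, A y, A x, A y] = S ![x, y, x, y]) (u v w t : V) :
    R ![A u, A v, A w, A t] = R ![u, v, w, t] := by
  have := h A.symm fun S hS => by
    rw [sectional_apply, tensorRep_apply_four]
    exact hA S hS
  conv_rhs => rw [← this, tensorRep_apply_four]
  rfl

variable (b : OrthonormalBasis ι ℝ V) {p q : ι} {R : CovTensor V 4}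

/-- When σ exchanges p and q, preservation of the sectional curvature needs the skew symmetries;
this is why `IsPlaneInvariant` tests isometries on curvature tensors only. -/
theorem IsPlaneInvariant.apply_perm (h : IsPlaneInvariant R (b p) (b q)) (σ : Equiv.Perm ι)
    (hσ : (σ p = p ∧ σ q = q) ∨ (σ p = q ∧ σ q = p)) (i j k l : ι) :
    R ![b (σ i), b (σ j), b (σ k), b (σ l)] = R ![b i, b j, b k, b l] := by
  have := h.apply (b.equiv b σ) (fun S hS => by
    simp only [b.equiv_apply_basis]
    rcases hσ with ⟨h1, h2⟩ | ⟨h1, h2⟩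
    · rw [h1, h2]
    · rw [h1, h2, swap_both hS]) (b i) (b j) (b k) (b l)
  simpa only [b.equiv_apply_basis] using this

variable [DecidableEq ι]

theorem reflection_basis (m i : ι) :
    (ℝ ∙ b m)ᗮ.reflection (b i) = (if i = m then (-1 : ℝ) else 1) • b i := by
  split_ifs with hi
  · rw [hi, Submodule.reflection_orthogonalComplement_singleton_eq_neg, neg_one_smul]
  · rw [one_smul]
    refine Submodule.reflection_mem_subspace_eq_self ?_
    rw [Submodule.mem_orthogonal_singleton_iff_inner_right, b.inner_eq_ite, if_neg (Ne.symm hi)]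

/-- Each plane vector occurs twice in the sectional curvature, so the reflection in any basis
vector, including those of the plane, preserves it. Components in which m occurs an odd number of
times must therefore vanish. -/
theorem IsPlaneInvariant.apply_reflection (h : IsPlaneInvariant R (b p) (b q)) (m i j k l : ι) :
    R ![b i, b j, b k, b l] = (if i = m then (-1 : ℝ) else 1) * (if j = m then (-1 : ℝ) else 1) *
      (if k = m then (-1 : ℝ) else 1) * (if l = m then (-1 : ℝ) else 1) *
        R ![b i, b j, b k, b l] := by
  rw [← map_smul_four]
  simp only [← reflection_basis]
  refine (h.apply _ (fun S _ => ?_) _ _ _ _).symm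
  simp only [reflection_basis]
  rw [map_smul_four]
  split_ifs <;> ring

/-- A plane-invariant curvature tensor has no off-diagonal components. -/
theorem IsPlaneInvariant.eq_zero (h : IsPlaneInvariant R (b p) (b q))
    (hR : R ∈ (curvTensors V).toSubmodule) (h0 : ∀ i j, i ≠ j → R ![b i, b j, b i, b j] = 0) :
    R = 0 := by
  -- Up to symmetry, every component other than R(i,j,i,j) either vanishes by skewness or contains
  -- an index exactly once, and reflecting in that index kills it.
  have h1 : ∀ i j l, i ≠ j → R ![b i, b j, b i, b l] = 0 := fun i j l hij => by
    by_cases hjl : j = l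
    · rw [← hjl, h0 i j hij]
    · have := h.apply_reflection b j i j i l
      rw [if_neg hij, if_pos rfl, if_neg (Ne.symm hjl)] at this
      linarith
  have h2 : ∀ i j k l, R ![b i, b j, b k, b l] = 0 := fun i j k l => by
    by_cases hij : i = j
    · rw [hij, apply_self_left hR]
    by_cases hik : i = k
    · rw [← hik, h1 i j l hij]
    by_cases hil : i = l
    · rw [← hil, skew_right hR, h1 i j k hij, neg_zero]
    · have := h.apply_reflection b i i j k l
      rw [if_pos rfl, if_neg (Ne.symm hij), if_neg (Ne.symm hik), if_neg (Ne.symm hil)] at this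
      linarith
  refine Module.Basis.ext_multilinear (fun _ => b.toBasis) fun v => ?_
  simp only [OrthonormalBasis.coe_toBasis]
  have hv : (fun a => b (v a)) = ![b (v 0), b (v 1), b (v 2), b (v 3)] := by
    ext a; fin_cases a <;> rfl
  rw [hv, h2, zero_apply]

end Invariance

/-! ### Kulkarni–Nomizu products as curvature tensors -/

section KulkarniNomizu

variable {V : Type*} [NormedAddCommGroup V] [InnerProductSpace ℝ V]

theorem kulkarniNomizu_apply_four (r s : LinearMap.BilinForm ℝ V) (x y z t : V) :
    kulkarniNomizu r s ![x, y, z, t] =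
      r x z * s y t + r y t * s x z - r x t * s y z - r y z * s x t := rfl

theorem metricKN_apply_four (h : symForms V) (x y z t : V) :
    metricKN V h ![x, y, z, t] =
      ⟪x, z⟫ * h.1 y t + ⟪y, t⟫ * h.1 x z - ⟪x, t⟫ * h.1 y z - ⟪y, z⟫ * h.1 x t := rfl

theorem kulkarniNomizu_mem (r s : symForms V) :
    kulkarniNomizu r.1 s.1 ∈ (curvTensors V).toSubmodule := by
  refine ⟨⟨fun x y z t => ?_, fun x y z t => ?_, fun x y z t => ?_⟩, fun x y z t => ?_⟩ <;>
    simp only [kulkarniNomizu_apply_four]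
  · ring
  · ring
  · rw [r.2 z x, r.2 t y, r.2 z y, r.2 t x, s.2 z x, s.2 t y, s.2 z y, s.2 t x]
    ring
  · rw [r.2 y x, r.2 z x, r.2 z y, s.2 y x, s.2 z x, s.2 z y]
    ring

theorem metricKN_mem (h : symForms V) : metricKN V h ∈ (curvTensors V).toSubmodule :=
  kulkarniNomizu_mem (metricForm V) h

/-- The symmetric product of the covectors dual to `x` and `y`. -/
noncomputable def symProd (x y : V) : symForms V :=
  ⟨(innerₗ V x).smulRight (innerₗ V y) + (innerₗ V y).smulRight (innerₗ V x), fun u v => by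
    simp
    ring⟩

theorem symProd_apply (x y u v : V) :
    (symProd x y).1 u v = ⟪x, u⟫ * ⟪y, v⟫ + ⟪y, u⟫ * ⟪x, v⟫ := by
  simp [symProd]

end KulkarniNomizu

/-! ### Inner products with g ∧⃝ h and the Ricci contraction -/

section Contraction

variable {V : Type*} [NormedAddCommGroup V] [InnerProductSpace ℝ V] [FiniteDimensional ℝ V]

local notation "e" => stdOrthonormalBasis ℝ V

theorem sum_fin_four {α : Type*} [Fintype α] (f : (Fin 4 → α) → ℝ) :
    ∑ i, f i = ∑ a, ∑ b, ∑ c, ∑ d, f ![a, b, c, d] := by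
  have key : ∀ (n : ℕ) (g : (Fin (n + 1) → α) → ℝ),
      ∑ i, g i = ∑ a, ∑ i : Fin n → α, g (Matrix.vecCons a i) := fun n g => by
    rw [← (Fin.consEquiv fun _ : Fin (n + 1) => α).sum_comp, Fintype.sum_prod_type]
    rfl
  simp only [key, Finset.univ_unique, Finset.sum_singleton]
  refine Finset.sum_congr rfl fun a _ => Finset.sum_congr rfl fun b _ =>
    Finset.sum_congr rfl fun c _ => Finset.sum_congr rfl fun d _ => ?_
  congr

theorem tensorInner_eq_sum (R S : CovTensor V 4) :
    tensorInner R S = ∑ i, ∑ j, ∑ k, ∑ l,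
      R ![e i, e j, e k, e l] * S ![e i, e j, e k, e l] := by
  rw [tensorInner, sum_fin_four]
  have hv : ∀ i j k l : Fin (Module.finrank ℝ V),
      (fun a => e (![i, j, k, l] a)) = ![e i, e j, e k, e l] := fun i j k l => by
    ext a; fin_cases a <;> rfl
  simp only [hv]

/-- The inner product with `g ∧⃝ h` is, up to a factor, the inner product of the Ricci
contraction with `h`. -/
theorem tensorInner_metricKN {R : CovTensor V 4} (hR : R ∈ (curvTensors V).toSubmodule)
    (h : symForms V) : tensorInner R (metricKN V h) =
      4 * ∑ i, ∑ j, ∑ k, R ![e i, e j, e i, e k] * h.1 (e j) (e k) := by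
  -- The four terms of the product g ∧⃝ h contribute the same contraction up to sign, by the
  -- symmetries of `R`; the signs match, whence the factor 4.
  have t1 : ∑ i, ∑ j, ∑ k, ∑ l, R ![e i, e j, e k, e l] * (⟪e i, e k⟫ * h.1 (e j) (e l)) =
      ∑ i, ∑ j, ∑ k, R ![e i, e j, e i, e k] * h.1 (e j) (e k) := by
    refine Finset.sum_congr rfl fun i _ => Finset.sum_congr rfl fun j _ => ?_
    rw [Finset.sum_comm]
    refine Finset.sum_congr rfl fun l _ => ?_
    simp [OrthonormalBasis.inner_eq_ite]
  have t2 : ∑ i, ∑ j, ∑ k, ∑ l, R ![e i, e j, e k, e l] * (⟪e j, e l⟫ * h.1 (e i) (e k)) =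
      ∑ i, ∑ j, ∑ k, R ![e i, e j, e i, e k] * h.1 (e j) (e k) := by
    rw [← t1, Finset.sum_comm]
    refine Finset.sum_congr rfl fun i _ => Finset.sum_congr rfl fun j _ => ?_
    rw [Finset.sum_comm]
    refine Finset.sum_congr rfl fun k _ => Finset.sum_congr rfl fun l _ => ?_
    rw [swap_both hR]
  have t3 : ∑ i, ∑ j, ∑ k, ∑ l, R ![e i, e j, e k, e l] * (⟪e i, e l⟫ * h.1 (e j) (e k)) =
      -∑ i, ∑ j, ∑ k, R ![e i, e j, e i, e k] * h.1 (e j) (e k) := by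
    simp only [← t1, ← Finset.sum_neg_distrib]
    refine Finset.sum_congr rfl fun i _ => Finset.sum_congr rfl fun j _ => ?_
    rw [Finset.sum_comm]
    refine Finset.sum_congr rfl fun k _ => Finset.sum_congr rfl fun l _ => ?_
    rw [skew_right hR, neg_mul]
  have t4 : ∑ i, ∑ j, ∑ k, ∑ l, R ![e i, e j, e k, e l] * (⟪e j, e k⟫ * h.1 (e i) (e l)) =
      -∑ i, ∑ j, ∑ k, R ![e i, e j, e i, e k] * h.1 (e j) (e k) := by
    simp only [← t1, ← Finset.sum_neg_distrib]
    rw [Finset.sum_comm]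
    refine Finset.sum_congr rfl fun i _ => Finset.sum_congr rfl fun j _ =>
      Finset.sum_congr rfl fun k _ => Finset.sum_congr rfl fun l _ => ?_
    rw [skew_left hR, neg_mul]
  rw [tensorInner_eq_sum]
  simp only [metricKN_apply_four, mul_add, mul_sub, Finset.sum_add_distrib,
    Finset.sum_sub_distrib, t1, t2, t3, t4]
  ring

theorem bilinTrace_metricForm :
    bilinTrace (metricForm V).1 = Module.finrank ℝ V := by
  simp [bilinTrace, metricForm]

theorem bilinTrace_symProd (x y : V) : bilinTrace (symProd x y).1 = 2 * ⟪x, y⟫ := by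
  have h : ∀ i, ⟪y, e i⟫ * ⟪x, e i⟫ = ⟪x, e i⟫ * ⟪e i, y⟫ := fun i => by
    rw [mul_comm, real_inner_comm y]
  have h' : ∀ i, ⟪x, e i⟫ * ⟪y, e i⟫ = ⟪x, e i⟫ * ⟪e i, y⟫ := fun i => by
    rw [real_inner_comm y]
  simp only [bilinTrace, symProd_apply, Finset.sum_add_distrib, h, h',
    OrthonormalBasis.sum_inner_mul_inner]
  ring

/-- The full double trace of g ∧⃝ h is 2(n - 1) tr h. -/
theorem tensorInner_metricKN_metricForm (h : symForms V)
    (ht : bilinTrace h.1 = 0) : tensorInner (metricKN V h) (metricKN V (metricForm V)) = 0 := by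
  have ht' : ∑ i, h.1 (e i) (e i) = 0 := ht
  rw [tensorInner_metricKN (metricKN_mem h)]
  simp [metricForm, metricKN_apply_four, OrthonormalBasis.inner_eq_ite, Finset.sum_add_distrib,
    Finset.sum_sub_distrib, ht', ← Finset.mul_sum]

end Contraction

/-! ### The orthogonal decomposition -/

section Parts

variable {V : Type*} [NormedAddCommGroup V] [InnerProductSpace ℝ V] [FiniteDimensional ℝ V]

local notation "e" => stdOrthonormalBasis ℝ V

omit [FiniteDimensional ℝ V] in
theorem mem_scalarPart {R : CovTensor V 4} :
    R ∈ (scalarPart V).toSubmodule ↔ ∃ c : ℝ, R = c • metricKN V (metricForm V) :=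
  Submodule.mem_span_singleton.trans ⟨fun ⟨c, h⟩ => ⟨c, h.symm⟩, fun ⟨c, h⟩ => ⟨c, h.symm⟩⟩

theorem mem_tracelessPart {R : CovTensor V 4} :
    R ∈ (tracelessPart V).toSubmodule ↔ ∃ h : symForms V, bilinTrace h.1 = 0 ∧ R = metricKN V h :=
  ⟨fun ⟨h, ht, hh⟩ => ⟨h, ht, hh.symm⟩, fun ⟨h, ht, hh⟩ => ⟨h, ht, hh.symm⟩⟩

/-- Splitting off the trace of h. Consequently, being a Weyl tensor can be tested against g ∧⃝ h for
every symmetric h. -/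
theorem scalarPart_sup_tracelessPart [Nontrivial V] :
    (scalarPart V).toSubmodule ⊔ (tracelessPart V).toSubmodule = LinearMap.range (metricKN V) := by
  refine le_antisymm (sup_le ?_ ?_) ?_
  · intro R hR
    obtain ⟨c, rfl⟩ := mem_scalarPart.1 hR
    exact ⟨c • metricForm V, map_smul _ _ _⟩
  · intro R hR
    obtain ⟨h, -, rfl⟩ := mem_tracelessPart.1 hR
    exact ⟨h, rfl⟩
  · rintro _ ⟨h, rfl⟩
    have hn : (Module.finrank ℝ V : ℝ) ≠ 0 := Nat.cast_ne_zero.2 Module.finrank_pos.ne'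
    set c := bilinTrace h.1 / Module.finrank ℝ V with hc
    refine Submodule.mem_sup.2 ⟨c • metricKN V (metricForm V), mem_scalarPart.2 ⟨c, rfl⟩,
      metricKN V (h + (-c) • metricForm V), mem_tracelessPart.2 ⟨_, ?_, rfl⟩, ?_⟩
    · have : bilinTrace (h + (-c) • metricForm V).1 =
          bilinTrace h.1 - c * bilinTrace (metricForm V).1 := by
        simp [bilinTrace, Finset.sum_add_distrib, Finset.mul_sum, sub_eq_add_neg]
      rw [this, bilinTrace_metricForm, hc, div_mul_cancel₀ _ hn, sub_self]
    · rw [map_add, map_smul, add_left_comm, ← add_smul, add_neg_cancel, zero_smul, add_zero]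

theorem mem_weylPart [Nontrivial V] {R : CovTensor V 4} :
    R ∈ (weylPart V).toSubmodule ↔
      R ∈ (curvTensors V).toSubmodule ∧ ∀ h, tensorInner R (metricKN V h) = 0 := by
  refine and_congr_right fun _ => ?_
  rw [scalarPart_sup_tracelessPart]
  exact Set.forall_mem_range

/-- Weyl tensors have zero Ricci contraction. -/
theorem sum_weyl_eq_zero [Nontrivial V] {R : CovTensor V 4}
    (hR : R ∈ (weylPart V).toSubmodule) (m : Fin (Module.finrank ℝ V)) :
    ∑ i, R ![e i, e m, e i, e m] = 0 := by
  -- Pairing with this form picks out the (m, m) entry of the Ricci contraction.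
  have h := (mem_weylPart.1 hR).2 (symProd (e m) (e m))
  rw [tensorInner_metricKN (mem_weylPart.1 hR).1] at h
  simp only [symProd_apply, OrthonormalBasis.inner_eq_ite, mul_ite, mul_one, mul_zero, mul_add,
    Finset.sum_add_distrib, Finset.sum_ite_eq, Finset.mem_univ, if_true] at h
  linarith

omit [FiniteDimensional ℝ V] in
theorem scalarPart_le : (scalarPart V).toSubmodule ≤ (curvTensors V).toSubmodule := fun R hR => by
  obtain ⟨c, rfl⟩ := mem_scalarPart.1 hR
  exact Submodule.smul_mem _ _ (metricKN_mem _)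

theorem tracelessPart_le : (tracelessPart V).toSubmodule ≤ (curvTensors V).toSubmodule :=
  fun R hR => by
    obtain ⟨h, -, rfl⟩ := mem_tracelessPart.1 hR
    exact metricKN_mem _

theorem weylPart_le : (weylPart V).toSubmodule ≤ (curvTensors V).toSubmodule :=
  fun _ hR => hR.1

theorem tensorInner_comm {k : ℕ} (R S : CovTensor V k) : tensorInner R S = tensorInner S R :=
  (tensorForm_isSymm k).eq R S

theorem disjoint_of_tensorInner_eq_zero {k : ℕ} {P Q : Submodule ℝ (CovTensor V k)}
    (h : ∀ R ∈ P, ∀ S ∈ Q, tensorInner R S = 0) : Disjoint P Q :=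
  Submodule.disjoint_def.2 fun R hP hQ => eq_zero_of_tensorInner_self R (h R hP R hQ)

theorem tensorInner_sup_right {k : ℕ} {P Q : Submodule ℝ (CovTensor V k)} {R : CovTensor V k}
    (hP : ∀ S ∈ P, tensorInner R S = 0) (hQ : ∀ S ∈ Q, tensorInner R S = 0) :
    ∀ S ∈ P ⊔ Q, tensorInner R S = 0 := by
  have h : P ⊔ Q ≤ LinearMap.ker (tensorForm V k R) := sup_le hP hQ
  exact h

theorem tensorInner_scalarPart_tracelessPart {R S : CovTensor V 4}
    (hR : R ∈ (scalarPart V).toSubmodule) (hS : S ∈ (tracelessPart V).toSubmodule) :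
    tensorInner R S = 0 := by
  obtain ⟨c, rfl⟩ := mem_scalarPart.1 hR
  obtain ⟨h, ht, rfl⟩ := mem_tracelessPart.1 hS
  rw [tensorInner_comm, ← tensorForm_apply, map_smul, tensorForm_apply,
    tensorInner_metricKN_metricForm h ht, smul_zero]

theorem iSupIndep_parts :
    iSupIndep ![(scalarPart V).toSubmodule, (tracelessPart V).toSubmodule,
      (weylPart V).toSubmodule] := by
  have hw : ∀ R ∈ (weylPart V).toSubmodule,
      ∀ S ∈ (scalarPart V).toSubmodule ⊔ (tracelessPart V).toSubmodule, tensorInner R S = 0 :=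
    fun R hR => hR.2
  refine iSupIndep_fin_three.2 ⟨?_, ?_, ?_⟩ <;> refine disjoint_of_tensorInner_eq_zero ?_
  · exact fun R hR => tensorInner_sup_right
      (fun S hS => tensorInner_scalarPart_tracelessPart hR hS)
      (fun S hS => (tensorInner_comm R S).trans (hw S hS R (Submodule.mem_sup_left hR)))
  · exact fun R hR => tensorInner_sup_right
      (fun S hS => (tensorInner_comm R S).trans (hw S hS R (Submodule.mem_sup_right hR)))
      (fun S hS => (tensorInner_comm R S).trans (tensorInner_scalarPart_tracelessPart hS hR))
  · exact hw

/-- Decompose along M and its orthogonal complement in the space of all 4-tensors. As M consists of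
curvature tensors, the orthogonal component of a curvature tensor is again one. -/
theorem sup_parts :
    (scalarPart V).toSubmodule ⊔ (tracelessPart V).toSubmodule ⊔ (weylPart V).toSubmodule =
      (curvTensors V).toSubmodule := by
  set M := (scalarPart V).toSubmodule ⊔ (tracelessPart V).toSubmodule with hM
  have hMT : M ≤ (curvTensors V).toSubmodule := sup_le scalarPart_le tracelessPart_le
  refine le_antisymm (sup_le hMT weylPart_le) fun R hR => ?_
  have hc := LinearMap.BilinForm.isCompl_orthogonal_of_restrict_nondegenerate
    (tensorForm_isSymm 4).isRefl
    (restrict_nondegenerate_of_anisotropic _ (tensorForm_isSymm 4)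
      (fun R h => eq_zero_of_tensorInner_self R h) M)
  obtain ⟨S, hS, W, hW, rfl⟩ :=
    Submodule.mem_sup.1 (hc.sup_eq_top ▸ Submodule.mem_top : R ∈ M ⊔ (tensorForm V 4).orthogonal M)
  refine Submodule.add_mem_sup hS ⟨?_, fun Q hQ => ?_⟩
  · simpa using sub_mem hR (hMT hS)
  · rw [tensorInner_comm]
    exact hW Q hQ

end Parts

/-! ### Irreducibility of the three parts -/

section Irreducible

variable {V : Type*} [NormedAddCommGroup V] [InnerProductSpace ℝ V] [FiniteDimensional ℝ V]

local notation "e" => stdOrthonormalBasis ℝ V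

/-- Irreducibility criterion for submodules of the curvature tensors, in terms of the tensors
that are invariant with respect to a fixed coordinate plane. -/
theorem isIrreducible_of_planeInvariant {σ : Subrepresentation (tensorRep V 4)}
    (hσ : σ.toSubmodule ≤ (curvTensors V).toSubmodule) (hne : ∃ R ∈ σ.toSubmodule, R ≠ 0)
    {p q : Fin (Module.finrank ℝ V)} (hpq : p ≠ q)
    (hfix : ∀ R ∈ σ.toSubmodule, IsPlaneInvariant R (e p) (e q) →
      R ![e p, e q, e p, e q] = 0 → ∀ i j, i ≠ j → R ![e i, e j, e i, e j] = 0) :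
    Representation.IsIrreducible (V := σ.toSubmodule) σ.toRepresentation :=
  isIrreducible_toRepresentation σ hne (sectional (e p) (e q))
    (fun _ hR => eq_zero_of_sectional_translates _ hpq (hσ hR))
    fun R hR h h0 =>
      -- An isometry preserving the functional on all curvature tensors preserves it on σ, so a
      -- vector fixed by the stabilizer on σ is plane-invariant.
      have hinv : IsPlaneInvariant R (e p) (e q) := fun A hA => h A fun S hS => hA S (hσ hS)
      hinv.eq_zero _ (hσ hR) (hfix R hR hinv h0)

omit [FiniteDimensional ℝ V] in
theorem exists_four (hV : 4 ≤ Module.finrank ℝ V) :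
    ∃ p q r s : Fin (Module.finrank ℝ V), p ≠ q ∧ r ≠ p ∧ r ≠ q ∧ s ≠ p ∧ s ≠ q ∧ s ≠ r :=
  ⟨⟨0, by omega⟩, ⟨1, by omega⟩, ⟨2, by omega⟩, ⟨3, by omega⟩, by simp⟩

omit [FiniteDimensional ℝ V] in
theorem nontrivial_of_four_le (hV : 4 ≤ Module.finrank ℝ V) : Nontrivial V :=
  Module.nontrivial_of_finrank_pos (R := ℝ) (by omega)

theorem isIrreducible_scalarPart (hV : 4 ≤ Module.finrank ℝ V) :
    Representation.IsIrreducible (V := (scalarPart V).toSubmodule)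
      (scalarPart V).toRepresentation := by
  obtain ⟨p, q, -, -, hpq, -⟩ := exists_four hV
  -- Constant sectional curvature: the value on one plane determines the scalar.
  have hg : ∀ i j, i ≠ j →
      metricKN V (metricForm V) ![e i, e j, e i, e j] = 2 := fun i j hij => by
    simp [metricKN_apply_four, metricForm, hij, hij.symm]
    norm_num
  refine isIrreducible_of_planeInvariant scalarPart_le ⟨_, mem_scalarPart.2 ⟨1, rfl⟩, fun h => ?_⟩
    hpq fun R hR _ h0 i j hij => ?_
  · have := hg p q hpq
    rw [one_smul] at h
    rw [h, zero_apply] at this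
    norm_num at this
  · obtain ⟨c, rfl⟩ := mem_scalarPart.1 hR
    rw [smul_apply, hg _ _ hpq] at h0
    rw [smul_apply, hg _ _ hij, h0]

theorem isIrreducible_tracelessPart (hV : 4 ≤ Module.finrank ℝ V) :
    Representation.IsIrreducible (V := (tracelessPart V).toSubmodule)
      (tracelessPart V).toRepresentation := by
  obtain ⟨p, q, r, s, hpq, hrp, hrq, -⟩ := exists_four hV
  refine isIrreducible_of_planeInvariant tracelessPart_le
    ⟨metricKN V (symProd (e p) (e q)), mem_tracelessPart.2 ⟨_, ?_, rfl⟩, fun h => ?_⟩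
    hpq fun R hR hinv h0 => ?_
  · simp [bilinTrace_symProd, hpq]
  · have := congrArg (fun R : CovTensor V 4 => R ![e p, e r, e q, e r]) h
    simp [metricKN_apply_four, symProd_apply, hpq, hpq.symm, hrp.symm, hrq, hrq.symm] at this
  · obtain ⟨h, ht, rfl⟩ := mem_tracelessPart.1 hR
    have hd : ∀ i j, i ≠ j → metricKN V h ![e i, e j, e i, e j] =
        h.1 (e i) (e i) + h.1 (e j) (e j) := fun i j hij => by
      simp [metricKN_apply_four, hij, hij.symm, add_comm]
    -- Exchanging p and q in the component (p, r, p, r) equates these entries, and `h0` says that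
    -- their sum is zero.
    have h1 : h.1 (e p) (e p) = h.1 (e q) (e q) := by
      have := hinv.apply_perm _ (Equiv.swap p q) (by simp) p r p r
      rw [Equiv.swap_apply_left, Equiv.swap_apply_of_ne_of_ne hrp hrq, hd _ _ hrq.symm,
        hd _ _ hrp.symm] at this
      linarith
    rw [hd _ _ hpq] at h0
    have h2 : ∀ i, i ≠ p → i ≠ q → h.1 (e i) (e i) = h.1 (e r) (e r) := fun i hip hiq => by
      have := hinv.apply_perm _ (Equiv.swap r i) (Or.inl
        ⟨Equiv.swap_apply_of_ne_of_ne hrp.symm hip.symm,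
          Equiv.swap_apply_of_ne_of_ne hrq.symm hiq.symm⟩) p r p r
      rw [Equiv.swap_apply_left, Equiv.swap_apply_of_ne_of_ne hrp.symm hip.symm, hd _ _ hip.symm,
        hd _ _ hrp.symm] at this
      linarith
    have hp : h.1 (e p) (e p) = 0 := by linarith
    have hq : h.1 (e q) (e q) = 0 := by linarith
    have ht' : ∑ i, h.1 (e i) (e i) = 0 := ht
    -- Off the plane all diagonal entries agree, so the zero trace is a positive multiple of this
    -- one; r itself shows that the count is nonzero.
    have hr : h.1 (e r) (e r) = 0 := by
      have hsum : ∑ i, h.1 (e i) (e i) =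
          (Finset.univ.filter fun i => i ≠ p ∧ i ≠ q).card * h.1 (e r) (e r) := by
        rw [← nsmul_eq_mul, ← Finset.sum_const, Finset.sum_filter]
        refine Finset.sum_congr rfl fun i _ => ?_
        split_ifs with hi
        · exact h2 i hi.1 hi.2
        · rcases not_and_or.1 hi with hi | hi <;> rw [not_not.1 hi] <;> assumption
      rw [ht', eq_comm, mul_eq_zero, Nat.cast_eq_zero, Finset.card_eq_zero] at hsum
      refine hsum.resolve_left fun hem => ?_
      exact Finset.notMem_empty r (hem ▸ by simp [hrp, hrq])
    have hall : ∀ i, h.1 (e i) (e i) = 0 := fun i => by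
      by_cases hip : i = p
      · rw [hip, hp]
      by_cases hiq : i = q
      · rw [hiq, hq]
      · rw [h2 i hip hiq, hr]
    intro i j hij
    rw [hd i j hij, hall, hall, add_zero]

/-- The Kulkarni–Nomizu product of the symmetric products of two pairs of covectors from an
orthonormal quadruple is a Weyl tensor. -/
theorem kulkarniNomizu_symProd_mem_weylPart [Nontrivial V] {p q r s : Fin (Module.finrank ℝ V)}
    (hpq : p ≠ q) (hrp : r ≠ p) (hrq : r ≠ q) (hsp : s ≠ p) (hsq : s ≠ q) (hsr : s ≠ r) :
    kulkarniNomizu (symProd (e p) (e q)).1 (symProd (e r) (e s)).1 ∈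
      (weylPart V).toSubmodule := by
  have hmem := kulkarniNomizu_mem (symProd (e p) (e q)) (symProd (e r) (e s))
  refine mem_weylPart.2 ⟨hmem, fun h => ?_⟩
  rw [tensorInner_metricKN hmem]
  -- The diagonal entries of both forms vanish, and a mixed term would need i in both {p, q} and {r,
  -- s}. Hence the Ricci contraction vanishes term by term.
  have h0 : ∀ i j k, kulkarniNomizu (symProd (e p) (e q)).1 (symProd (e r) (e s)).1
      ![e i, e j, e i, e k] = 0 := fun i j k => by
    simp only [kulkarniNomizu_apply_four, symProd_apply, OrthonormalBasis.inner_eq_ite]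
    by_cases hip : p = i <;> by_cases hiq : q = i <;> by_cases hir : r = i <;>
      by_cases his : s = i <;> simp_all
  simp [h0]

theorem isIrreducible_weylPart (hV : 4 ≤ Module.finrank ℝ V) :
    Representation.IsIrreducible (V := (weylPart V).toSubmodule)
      (weylPart V).toRepresentation := by
  have := nontrivial_of_four_le hV
  obtain ⟨p, q, r, s, hpq, hrp, hrq, hsp, hsq, hsr⟩ := exists_four hV
  refine isIrreducible_of_planeInvariant weylPart_le
    ⟨_, kulkarniNomizu_symProd_mem_weylPart hpq hrp hrq hsp hsq hsr, fun h => ?_⟩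
    hpq fun R hR hinv h0 => ?_
  · have := congrArg (fun R : CovTensor V 4 => R ![e p, e r, e q, e s]) h
    simp [kulkarniNomizu_apply_four, symProd_apply, hpq, hpq.symm,
      hrp, hrp.symm, hrq, hrq.symm, hsp, hsp.symm, hsq, hsq.symm, hsr, hsr.symm] at this
  · have hRT := weylPart_le hR
    -- a component in a direction outside the plane does not depend on that direction
    have hswap : ∀ m k l, k ≠ p → k ≠ q → l ≠ p → l ≠ q → k ≠ m → l ≠ m →
        R ![e k, e m, e k, e m] = R ![e l, e m, e l, e m] := fun m k l hkp hkq hlp hlq hkm hlm => by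
      have := hinv.apply_perm _ (Equiv.swap k l) (Or.inl
        ⟨Equiv.swap_apply_of_ne_of_ne hkp.symm hlp.symm,
          Equiv.swap_apply_of_ne_of_ne hkq.symm hlq.symm⟩) l m l m
      rwa [Equiv.swap_apply_right, Equiv.swap_apply_of_ne_of_ne hkm.symm hlm.symm] at this
    -- For fixed m the sectional curvatures R(i,m,i,m) sum to zero. If those with i = p, q vanish,
    -- the remaining ones with i ≠ m are all equal, hence zero.
    have hric : ∀ m k, k ≠ p → k ≠ q → k ≠ m →
        (∀ i, i = p ∨ i = q → R ![e i, e m, e i, e m] = 0) → R ![e k, e m, e k, e m] = 0 :=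
      fun m k hkp hkq hkm hz => by
        have hsum : ∑ i, R ![e i, e m, e i, e m] =
            (Finset.univ.filter fun i => i ≠ p ∧ i ≠ q ∧ i ≠ m).card *
              R ![e k, e m, e k, e m] := by
          rw [← nsmul_eq_mul, ← Finset.sum_const, Finset.sum_filter]
          refine Finset.sum_congr rfl fun i _ => ?_
          split_ifs with hi
          · exact hswap m i k hi.1 hi.2.1 hkp hkq hi.2.2 hkm
          · by_cases him : i = m
            · rw [him, apply_self_left hRT]
            · exact hz i (by tauto)
        rw [sum_weyl_eq_zero hR, eq_comm, mul_eq_zero, Nat.cast_eq_zero,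
          Finset.card_eq_zero] at hsum
        refine hsum.resolve_left fun hem => ?_
        exact Finset.notMem_empty k (hem ▸ by simp [hkp, hkq, hkm])
    have hq0 : R ![e q, e p, e q, e p] = 0 := by rw [swap_both hRT, h0]
    have hkp0 : ∀ k, R ![e k, e p, e k, e p] = 0 := fun k => by
      by_cases hkp : k = p
      · rw [hkp, apply_self_left hRT]
      by_cases hkq : k = q
      · rw [hkq, hq0]
      · refine hric p k hkp hkq hkp ?_
        rintro i (rfl | rfl)
        · exact apply_self_left hRT _ _ _
        · exact hq0
    have hkq0 : ∀ k, R ![e k, e q, e k, e q] = 0 := fun k => by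
      by_cases hkq : k = q
      · rw [hkq, apply_self_left hRT]
      by_cases hkp : k = p
      · rw [hkp, h0]
      · refine hric q k hkp hkq hkq ?_
        rintro i (rfl | rfl)
        · exact h0
        · exact apply_self_left hRT _ _ _
    have hmp0 : ∀ m i, i = p ∨ i = q → R ![e i, e m, e i, e m] = 0 := by
      rintro m i (rfl | rfl)
      · rw [swap_both hRT, hkp0]
      · rw [swap_both hRT, hkq0]
    intro i j hij
    by_cases hip : i = p
    · exact hmp0 j i (Or.inl hip)
    by_cases hiq : i = q
    · exact hmp0 j i (Or.inr hiq)
    · exact hric j i hip hiq hij (hmp0 j)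

end Irreducible
end AlgCurv

theorem mainTheorem5 {V : Type*} [NormedAddCommGroup V] [InnerProductSpace ℝ V]
    [FiniteDimensional ℝ V] (hV : 4 ≤ Module.finrank ℝ V) :
    (iSupIndep ![(AlgCurv.scalarPart V).toSubmodule, (AlgCurv.tracelessPart V).toSubmodule,
        (AlgCurv.weylPart V).toSubmodule] ∧
      (AlgCurv.scalarPart V).toSubmodule ⊔ (AlgCurv.tracelessPart V).toSubmodule ⊔
        (AlgCurv.weylPart V).toSubmodule = (AlgCurv.curvTensors V).toSubmodule) ∧
    Representation.IsIrreducible (V := (AlgCurv.scalarPart V).toSubmodule)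
      (AlgCurv.scalarPart V).toRepresentation ∧
    Representation.IsIrreducible (V := (AlgCurv.tracelessPart V).toSubmodule)
      (AlgCurv.tracelessPart V).toRepresentation ∧
    Representation.IsIrreducible (V := (AlgCurv.weylPart V).toSubmodule)
      (AlgCurv.weylPart V).toRepresentation :=
  ⟨⟨AlgCurv.iSupIndep_parts, AlgCurv.sup_parts⟩, AlgCurv.isIrreducible_scalarPart hV,
    AlgCurv.isIrreducible_tracelessPart hV, AlgCurv.isIrreducible_weylPart hV⟩
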